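/- Let $M,N\ge 1$ be integers. In the $3\times3$ partially cooperative MIMO X-multicast channel there are three transmitters with $M$ antennas each and three receivers with $N$ antennas each. For every set $I$ of two transmitters and every set $J$ of two receivers there is an independent message $W_{J,I}$, known exactly to the two transmitters in $I$ and desired by the two receivers in $J$ (nine messages; each receiver desires six of them). At time $t$ receiver $j$ observes $$y_j(t)=\sum_{i=1}^{3} H_{ji}\,x_i(t)+n_j(t),$$ where $x_i(t)\in\mathbb C^M$ is sent by transmitter $i$ under the power constraint $\|x_i(t)\|^2\le P$, the entries of the noise $n_j(t)$ are i.i.d. circularly symmetric complex Gaussian with mean $0$ and variance $1$, and the matrices $H_{ji}\in\mathbb C^{N\times M}$ are constant in time, known to all nodes, and have i.i.d. entries drawn from a continuous (atomless) distribution on $\mathbb C$. A number $d$ is an achievable DoF per user for a given channel if for every $P>0$ there is a rate $R(P)$ such that all nine messages can simultaneously be sent at rate $R(P)$ (bits per channel use) with error probability tending to $0$ as the block length tends to infinity, and $6R(P)=d\log_2 P+o(\log P)$ as $P\to\infty$. Define $$d_{12}=\begin{cases} N, & \frac NM\in(0,1],\\ M, & \frac NM\in(1,\frac32],\\ \frac{2N}{3},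 & \frac NM\in(\frac32,3],\\ 2M, & \frac NM\in(3,\infty).\end{cases}$$ Then, for almost every channel realization, $d_{12}$ is an achievable DoF per user. Moreover, it is attained by linear schemes with finite symbol extensions: there are integers $T\ge1$ and $b\ge0$ with $6b/T=d_{12}$ such that, for almost every channel realization, there is a linear precoding of $b$ symbols of each of the nine messages over $T$ channel uses, each message being precoded by the two transmitters that know it, for which every receiver can recover from its noiseless received signal, by linear combining, each desired symbol free of interference from all the other symbols. -/

import Mathlib

open MeasureTheory ProbabilityTheory Filter Topology
open scoped Kronecker

noncomputable section

namespace XMulticast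

/-- A set of two out of three nodes: a transmit cooperation group or a receive multicast group. -/
abbrev Pair : Type := {S : Finset (Fin 3) // S.card = 2}

/-- The nine independent messages. The message `a = (J, I)` is known to the two transmitters in
`I` and is desired by the two receivers in `J`. -/
abbrev Msg : Type := Pair × Pair

/-- The messages desired by receiver `j`. -/
abbrev Desired (j : Fin 3) : Type := {a : Msg // j ∈ a.1.1}

/-- Each receiver desires six messages. -/
theorem card_desired (j : Fin 3) : Fintype.card (Desired j) = 6 := by
  revert j; decide

/-- All channel coefficients of the network with `M` antennas per transmitter and `N` antennas per
receiver: `h (j, i, n, m)` is the gain from antenna `m` of transmitter `i` to antenna `n` of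
receiver `j`. -/
abbrev Channel (M N : ℕ) : Type := Fin 3 × Fin 3 × Fin N × Fin M → ℂ

/-- The `N × M` channel matrix from transmitter `i` to receiver `j`. -/
def Channel.mat {M N : ℕ} (h : Channel M N) (j i : Fin 3) : Matrix (Fin N) (Fin M) ℂ :=
  Matrix.of fun n m => h (j, i, n, m)

/-- The law of the channel when all its entries are i.i.d. with law `ν`. -/
def channelLaw (ν : Measure ℂ) [IsProbabilityMeasure ν] (M N : ℕ) : Measure (Channel M N) :=
  Measure.pi fun _ => ν

/-! ### Operational degrees of freedom -/

/-- The circularly symmetric complex Gaussian law with zero mean and unit variance. -/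
def complexGaussian : Measure ℂ :=
  ((gaussianReal 0 (1 / 2)).prod (gaussianReal 0 (1 / 2))).map Complex.measurableEquivRealProd.symm

/-- The additive white Gaussian noise at one receiver over `T` channel uses. -/
def noise (T N : ℕ) : Measure (Fin T → Fin N → ℂ) :=
  Measure.pi fun _ => Measure.pi fun _ => complexGaussian

/-- A code of block length `T` for the partially cooperative X-multicast channel, with `K` possible
values for each of the nine messages and power `P` per transmitter and channel use. -/
structure Code (M N T K : ℕ) (P : ℝ) where
  /-- `enc i w t` is the vector sent by transmitter `i` at time `t` for the messages `w`. -/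
  enc : Fin 3 → (Msg → Fin K) → Fin T → Fin M → ℂ
  /-- A transmitter uses only the messages of the cooperation groups to which it belongs. -/
  enc_local : ∀ (i : Fin 3) (w w' : Msg → Fin K),
    (∀ a : Msg, i ∈ a.2.1 → w a = w' a) → enc i w = enc i w'
  power : ∀ (i : Fin 3) (w : Msg → Fin K) (t : Fin T), ∑ m, ‖enc i w t m‖ ^ 2 ≤ P
  /-- Receiver `j` estimates the messages that it desires from its received signal. -/
  dec : (j : Fin 3) → (Fin T → Fin N → ℂ) → Desired j → Fin K
  dec_measurable : ∀ j, Measurable (dec j)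

/-- The signal at receiver `j`: channel outputs plus the noise `z`. -/
def received {M N T : ℕ} (h : Channel M N) (j : Fin 3) (x : Fin 3 → Fin T → Fin M → ℂ)
    (z : Fin T → Fin N → ℂ) : Fin T → Fin N → ℂ :=
  fun t => ∑ i, (h.mat j i).mulVec (x i t) + z t

/-- The probability, over independent uniform messages and the noise, that receiver `j` decodes at
least one of its desired messages wrongly. -/
def Code.errorProb {M N T K : ℕ} {P : ℝ} (c : Code M N T K P) (h : Channel M N) (j : Fin 3) : ℝ :=
  (∑ w : Msg → Fin K, (noise T N).real
      {z | c.dec j (received h j (fun i => c.enc i w) z) ≠ fun a => w a.1}) /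
    Fintype.card (Msg → Fin K)

/-- Over the channel `h`, known to all nodes, each of the nine messages can have rate `R` (in bits
per channel use) at power `P`, with vanishing error probability. -/
def RateAchievable {M N : ℕ} (h : Channel M N) (P R : ℝ) : Prop :=
  ∀ ε : ℝ, 0 < ε → ∀ᶠ T : ℕ in atTop, ∃ K : ℕ, (2 : ℝ) ^ ((T : ℝ) * R) ≤ K ∧
    ∃ c : Code M N T K P, ∀ j, c.errorProb h j ≤ ε

/-- `d` degrees of freedom per user are achievable over `h`: every message can have a rate `R P`
such that the rate `6 * R P` delivered to each receiver is `d * log P + o(log P)`. -/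
def DoFAchievable {M N : ℕ} (h : Channel M N) (d : ℝ) : Prop :=
  ∃ R : ℝ → ℝ, (∀ P : ℝ, 0 < P → RateAchievable h P (R P)) ∧
    Tendsto (fun P : ℝ => 6 * R P / Real.logb 2 P) atTop (𝓝 d)

/-! ### Linear schemes with finite symbol extensions -/

/-- The `(T * N) × b` matrix through which receiver `j` sees the `b` streams of a message, when
transmitter `i` precodes them by `V i` over `T` uses of the constant channel `h`. -/
def effective {M N T b : ℕ} (h : Channel M N) (j : Fin 3)
    (V : Fin 3 → Matrix (Fin T × Fin M) (Fin b) ℂ) : Matrix (Fin T × Fin N) (Fin b) ℂ :=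
  ∑ i, ((1 : Matrix (Fin T) (Fin T) ℂ) ⊗ₖ h.mat j i) * V i

/-- A linear scheme over a `T`-symbol extension of `h` with `b` streams for every message: each
message is precoded by the two transmitters that know it, and each receiver recovers linearly every
stream that it desires, free of interference from all other streams. -/
structure LinearScheme {M N : ℕ} (h : Channel M N) (T b : ℕ) where
  precoder : Msg → Fin 3 → Matrix (Fin T × Fin M) (Fin b) ℂ
  precoder_local : ∀ (a : Msg) (i : Fin 3), i ∉ a.2.1 → precoder a i = 0
  filter : (j : Fin 3) → Desired j → Matrix (Fin b) (Fin T × Fin N) ℂ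
  recovers : ∀ (j : Fin 3) (a : Desired j) (a' : Msg),
    filter j a * effective h j (precoder a') = if a' = a.1 then 1 else 0

/-- Linear schemes over a finite symbol extension give `d` interference-free streams per user and
channel use, for almost all channels with i.i.d. entries of law `ν`. -/
def LinearDoFAchievable (ν : Measure ℂ) [IsProbabilityMeasure ν] (M N : ℕ) (d : ℝ) : Prop :=
  ∃ T b : ℕ, 0 < T ∧ 6 * (b : ℝ) / T = d ∧
    ∀ᵐ h ∂channelLaw ν M N, Nonempty (LinearScheme h T b)

/-- The degrees of freedom per user, as a function of the antenna numbers. -/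
def d₁₂ (M N : ℕ) : ℝ :=
  if (N : ℝ) / M ≤ 1 then N
  else if (N : ℝ) / M ≤ 3 / 2 then M
  else if (N : ℝ) / M ≤ 3 then 2 * N / 3
  else 2 * M

end XMulticast

end

noncomputable section

namespace XMulticast

/-! ### Generic channels -/

theorem measurableSet_eval_eq_zero {ι : Type*} [Fintype ι] (p : MvPolynomial ι ℂ) :
    MeasurableSet {x : ι → ℂ | MvPolynomial.eval x p = 0} :=
  (isClosed_eq (MvPolynomial.continuous_eval p) continuous_const).measurableSet

theorem measure_eval_eq_zero_fin (ν : Measure ℂ) [IsProbabilityMeasure ν] [NullSingletonClass ν] :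
    ∀ (n : ℕ) (p : MvPolynomial (Fin n) ℂ), p ≠ 0 →
      (Measure.pi fun _ : Fin n => ν) {x | MvPolynomial.eval x p = 0} = 0
  | 0, p, hp => by
    have h : {x : Fin 0 → ℂ | MvPolynomial.eval x p = 0} = ∅ := by
      ext x
      simp only [Set.mem_ofPred_eq, Set.mem_empty_iff_false, iff_false]
      intro hx
      apply hp
      apply MvPolynomial.funext
      intro y
      rw [Subsingleton.elim y x, hx, map_zero]
    rw [h, measure_empty]
  | n + 1, p, hp => by
    set q := MvPolynomial.finSuccEquiv ℂ n p with hq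
    have hq0 : q ≠ 0 := by
      rw [hq]
      exact (map_ne_zero_iff _ (MvPolynomial.finSuccEquiv ℂ n).injective).2 hp
    have hlead := measure_eval_eq_zero_fin ν n q.leadingCoeff
      (Polynomial.leadingCoeff_ne_zero.2 hq0)
    have hmp := (measurePreserving_piFinSuccAbove (fun _ : Fin (n + 1) => ν) 0).symm
    rw [← hmp.measure_preimage (measurableSet_eval_eq_zero p).nullMeasurableSet,
      Measure.prod_apply_symm (hmp.measurable (measurableSet_eval_eq_zero p)),
      lintegral_eq_zero_iff' (by
        exact (measurable_measure_prodMk_right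
          (hmp.measurable (measurableSet_eval_eq_zero p))).aemeasurable)]
    have hae : ∀ᵐ x ∂(Measure.pi fun _ : Fin n => ν),
        MvPolynomial.eval x q.leadingCoeff ≠ 0 := by
      rw [ae_iff]
      simpa using hlead
    filter_upwards [hae] with x hx
    have hpoly : Polynomial.map (MvPolynomial.eval x) q ≠ 0 := by
      intro h0
      apply hx
      have := congrArg (fun r => Polynomial.coeff r q.natDegree) h0
      simpa [Polynomial.coeff_map] using this
    refine measure_mono_null ?_
      ((Polynomial.map (MvPolynomial.eval x) q).roots.toFinset.finite_toSet.measure_zero ν)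
    intro y hy
    have hy' : MvPolynomial.eval (Fin.cons y x : Fin (n + 1) → ℂ) p = 0 := by
      have := hy
      simpa [Fin.insertNthEquiv] using this
    rw [MvPolynomial.eval_eq_eval_mv_eval'] at hy'
    simp only [Finset.mem_coe, Multiset.mem_toFinset]
    exact (Polynomial.mem_roots hpoly).2 hy'

/-- A nonzero polynomial does not vanish almost surely at a point with i.i.d. coordinates whose law
has no atoms. -/
theorem ae_eval_ne_zero {ι : Type*} [Fintype ι] (ν : Measure ℂ) [IsProbabilityMeasure ν]
    [NullSingletonClass ν] {p : MvPolynomial ι ℂ} (hp : p ≠ 0) :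
    ∀ᵐ x ∂(Measure.pi fun _ : ι => ν), MvPolynomial.eval x p ≠ 0 := by
  let e := Fintype.equivFin ι
  have hmp := measurePreserving_piCongrLeft (fun _ : Fin (Fintype.card ι) => ν) e
  have h := measure_eval_eq_zero_fin ν _ (MvPolynomial.rename e p)
    ((map_ne_zero_iff _ (MvPolynomial.rename_injective _ e.injective)).2 hp)
  rw [← hmp.measure_preimage (measurableSet_eval_eq_zero _).nullMeasurableSet] at h
  rw [ae_iff]
  refine measure_mono_null ?_ h
  intro x hx
  simp only [ne_eq, not_not, Set.mem_ofPred_eq, Set.mem_preimage] at hx ⊢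
  rw [MvPolynomial.eval_rename]
  convert hx using 2
  congr 1
  ext i
  exact MeasurableEquiv.piCongrLeft_apply_apply (β := fun _ => ℂ) e x i

theorem ae_channelLaw_eval_ne_zero (ν : Measure ℂ) [IsProbabilityMeasure ν] [NullSingletonClass ν]
    {M N : ℕ} (p : MvPolynomial (Fin 3 × Fin 3 × Fin N × Fin M) ℂ) (h₀ : Channel M N)
    (hp : MvPolynomial.eval h₀ p ≠ 0) :
    ∀ᵐ h ∂channelLaw ν M N, MvPolynomial.eval h p ≠ 0 :=
  ae_eval_ne_zero ν (by rintro rfl; simp at hp)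

/-! ### The matrix seen through a linear scheme -/

theorem effective_apply {M N T b : ℕ} (h : Channel M N) (j : Fin 3)
    (V : Fin 3 → Matrix (Fin T × Fin M) (Fin b) ℂ) (t : Fin T) (n : Fin N) (l : Fin b) :
    effective h j V (t, n) l = ∑ i, ∑ m, h (j, i, n, m) * V i (t, m) l := by
  simp only [effective, Matrix.sum_apply, Matrix.mul_apply, Matrix.kroneckerMap_apply,
    Fintype.sum_prod_type, Matrix.one_apply, Channel.mat, Matrix.of_apply, ite_mul, one_mul,
    zero_mul]
  refine Finset.sum_congr rfl fun i _ => ?_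
  rw [Finset.sum_eq_single t] <;> simp +contextual [eq_comm]

/-- Every set of two nodes is the complement of a node. -/
theorem Pair.exists_compl (J : Pair) : ∃ k : Fin 3, ∀ j, j ∈ J.1 ↔ j ≠ k := by
  revert J; decide

theorem Pair.exists_eq (I : Pair) : ∃ i i' : Fin 3, i ≠ i' ∧ ∀ l, l ∈ I.1 ↔ l = i ∨ l = i' := by
  revert I; decide

/-- The node missing from a set of two nodes. -/
def Pair.compl (J : Pair) : Fin 3 := J.exists_compl.choose

theorem Pair.mem_iff (J : Pair) (j : Fin 3) : j ∈ J.1 ↔ j ≠ J.compl := J.exists_compl.choose_spec j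

theorem Pair.compl_injective : Function.Injective Pair.compl := by
  intro J J' h
  apply Subtype.ext
  ext j
  rw [J.mem_iff, J'.mem_iff, h]

/-- One of the two nodes of a pair. -/
def Pair.fst (I : Pair) : Fin 3 := I.exists_eq.choose

/-- The other node of a pair. -/
def Pair.snd (I : Pair) : Fin 3 := I.exists_eq.choose_spec.choose

theorem Pair.fst_ne_snd (I : Pair) : I.fst ≠ I.snd := I.exists_eq.choose_spec.choose_spec.1

theorem Pair.mem_iff_fst_snd (I : Pair) (l : Fin 3) : l ∈ I.1 ↔ l = I.fst ∨ l = I.snd :=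
  I.exists_eq.choose_spec.choose_spec.2 l

/-- The columns of the identity matrix of size `n` that belong to the first `L` coordinates. -/
def firstCols (n L : ℕ) (hL : L ≤ n) : Matrix (Fin n) (Fin L) ℂ :=
  Matrix.of fun i l => if i = Fin.castLE hL l then 1 else 0

/-- The channel matrix between the first `L` antennas of a receiver and of a transmitter. -/
def Channel.sub {M N : ℕ} (h : Channel M N) {L : ℕ} (hM : L ≤ M) (hN : L ≤ N) (j i : Fin 3) :
    Matrix (Fin L) (Fin L) ℂ :=
  Matrix.of fun n m => h (j, i, Fin.castLE hN n, Fin.castLE hM m)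

theorem firstCols_transpose_mul {m : Type*} {n L : ℕ} (hL : L ≤ n) (A : Matrix (Fin n) m ℂ) :
    (firstCols n L hL).transpose * A = Matrix.of fun l c => A (Fin.castLE hL l) c := by
  ext l c
  simp [firstCols, Matrix.mul_apply]

theorem mul_firstCols {m : Type*} {n L : ℕ} (hL : L ≤ n) (A : Matrix m (Fin n) ℂ) :
    A * firstCols n L hL = Matrix.of fun r l => A r (Fin.castLE hL l) := by
  ext l c
  simp [firstCols, Matrix.mul_apply]

theorem firstCols_mat_firstCols {M N : ℕ} (h : Channel M N) {L : ℕ} (hM : L ≤ M) (hN : L ≤ N)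
    (j i : Fin 3) : (firstCols N L hN).transpose * (h.mat j i * firstCols M L hM) =
      h.sub hM hN j i := by
  rw [mul_firstCols, firstCols_transpose_mul]
  ext; simp [Channel.sub, Channel.mat]

/-! ### Zero forcing -/

/-- The channel from a zero-forced message to receiver `j`, when the transmitters `i` and `i'` use
the inverses of their channels to receiver `k` with opposite signs. -/
def zeroForced {M N : ℕ} (h : Channel M N) {L : ℕ} (hM : L ≤ M) (hN : L ≤ N) (j k i i' : Fin 3) :
    Matrix (Fin L) (Fin L) ℂ :=
  h.sub hM hN j i * (h.sub hM hN k i)⁻¹ - h.sub hM hN j i' * (h.sub hM hN k i')⁻¹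

/-- The channel matrix between the first antennas, as a matrix of indeterminates. -/
def subX {M N L : ℕ} (hM : L ≤ M) (hN : L ≤ N) (j i : Fin 3) :
    Matrix (Fin L) (Fin L) (MvPolynomial (Fin 3 × Fin 3 × Fin N × Fin M) ℂ) :=
  Matrix.of fun n m => MvPolynomial.X (j, i, Fin.castLE hN n, Fin.castLE hM m)

theorem mapMatrix_subX {M N L : ℕ} (hM : L ≤ M) (hN : L ≤ N) (h : Channel M N) (j i : Fin 3) :
    (MvPolynomial.eval h).mapMatrix (subX hM hN j i) = h.sub hM hN j i := by
  ext; simp [subX, Channel.sub]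

theorem ae_isUnit_det_sub (ν : Measure ℂ) [IsProbabilityMeasure ν] [NullSingletonClass ν]
    {M N L : ℕ} (hM : L ≤ M) (hN : L ≤ N) (j i : Fin 3) :
    ∀ᵐ h ∂channelLaw ν M N, IsUnit (h.sub hM hN j i).det := by
  have key : ∀ h : Channel M N,
      MvPolynomial.eval h (subX hM hN j i).det = (h.sub hM hN j i).det := by
    intro h
    rw [RingHom.map_det, mapMatrix_subX]
  have := ae_channelLaw_eval_ne_zero ν (subX hM hN j i).det
    (fun x => if x.2.2.1.val = x.2.2.2.val then 1 else 0) (by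
      rw [key]
      have : (Channel.sub (fun x : Fin 3 × Fin 3 × Fin N × Fin M =>
          if x.2.2.1.val = x.2.2.2.val then (1 : ℂ) else 0) hM hN j i) = 1 := by
        ext n m
        simp [Channel.sub, Matrix.one_apply, Fin.ext_iff]
      rw [this, Matrix.det_one]
      exact one_ne_zero)
  filter_upwards [this] with h hh
  rw [key] at hh
  exact hh.isUnit

theorem ae_isUnit_det_zeroForced (ν : Measure ℂ) [IsProbabilityMeasure ν] [NullSingletonClass ν]
    {M N L : ℕ} (hM : L ≤ M) (hN : L ≤ N) {j k i i' : Fin 3} (hjk : j ≠ k) (hii : i ≠ i') :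
    ∀ᵐ h ∂channelLaw ν M N, IsUnit (zeroForced h hM hN j k i i').det := by
  let p : MvPolynomial (Fin 3 × Fin 3 × Fin N × Fin M) ℂ :=
    ((subX hM hN k i').det • (subX hM hN j i * (subX hM hN k i).adjugate) -
      (subX hM hN k i).det • (subX hM hN j i' * (subX hM hN k i').adjugate)).det
  have key : ∀ h : Channel M N, MvPolynomial.eval h p =
      ((h.sub hM hN k i').det • (h.sub hM hN j i * (h.sub hM hN k i).adjugate) -
      (h.sub hM hN k i).det • (h.sub hM hN j i' * (h.sub hM hN k i').adjugate)).det := by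
    intro h
    have hs : ∀ (c : MvPolynomial (Fin 3 × Fin 3 × Fin N × Fin M) ℂ)
        (A : Matrix (Fin L) (Fin L) (MvPolynomial (Fin 3 × Fin 3 × Fin N × Fin M) ℂ)),
        (MvPolynomial.eval h).mapMatrix (c • A) =
          MvPolynomial.eval h c • (MvPolynomial.eval h).mapMatrix A := by
      intro c A; ext; simp
    simp only [p]
    rw [RingHom.map_det, map_sub, hs, hs, map_mul, map_mul, RingHom.map_adjugate,
      RingHom.map_adjugate, RingHom.map_det, RingHom.map_det]
    simp only [mapMatrix_subX]
  have hp := ae_channelLaw_eval_ne_zero ν p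
    (fun x => if x.1 = j ∧ x.2.1 = i' then 0 else if x.2.2.1.val = x.2.2.2.val then 1 else 0) (by
      rw [key]
      set h₀ : Channel M N := fun x => if x.1 = j ∧ x.2.1 = i' then 0
        else if x.2.2.1.val = x.2.2.2.val then 1 else 0 with hh₀
      have h1 : ∀ j₁ i₁, ¬ (j₁ = j ∧ i₁ = i') → h₀.sub hM hN j₁ i₁ = 1 := by
        intro j₁ i₁ hne
        ext n m
        simp only [Channel.sub, Matrix.of_apply, hh₀, if_neg hne]
        simp [Matrix.one_apply, Fin.ext_iff]
      have h2 : h₀.sub hM hN j i' = 0 := by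
        ext n m
        simp [Channel.sub, hh₀]
      rw [h1 k i' (fun h => hjk h.1.symm), h1 k i (fun h => hjk h.1.symm), h1 j i (fun h => hii h.2),
        h2]
      simp)
  filter_upwards [hp, ae_isUnit_det_sub ν hM hN k i, ae_isUnit_det_sub ν hM hN k i']
    with h hh hi hi'
  rw [key] at hh
  have hrel : ((h.sub hM hN k i').det • (h.sub hM hN j i * (h.sub hM hN k i).adjugate) -
      (h.sub hM hN k i).det • (h.sub hM hN j i' * (h.sub hM hN k i').adjugate)) =
      ((h.sub hM hN k i).det * (h.sub hM hN k i').det) • zeroForced h hM hN j k i i' := by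
    rw [zeroForced, Matrix.inv_def, Matrix.inv_def, smul_sub, Matrix.mul_smul, Matrix.mul_smul,
      smul_smul, smul_smul, mul_right_comm, Ring.mul_inverse_cancel _ hi, mul_assoc,
      Ring.mul_inverse_cancel _ hi', one_mul, mul_one]
  rw [hrel, Matrix.det_smul] at hh
  exact (right_ne_zero_of_mul hh).isUnit

/-- Receiver `j` separates the directions `(1, k)` and `(1, k')` of the two groups of messages that
it desires, where `j + k + k' = 3`. -/
theorem exists_time_directions : ∃ (u : Msg → Fin 6 → ℂ) (φ : (j : Fin 3) → Desired j → Fin 6 → ℂ),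
    ∀ (j : Fin 3) (a a' : Desired j), ∑ t, φ j a t * u a'.1 t = if a'.1 = a.1 then 1 else 0 := by
  let e : Fin 6 ≃ Pair × Fin 2 := (Fintype.equivFinOfCardEq (by decide)).symm
  let v : Fin 3 → Fin 2 → ℂ := fun k s => if s = 0 then 1 else (k : ℂ)
  let w : Fin 3 → Fin 3 → Fin 2 → ℂ := fun j k s =>
    (if s = 0 then 3 - (j : ℂ) - k else -1) / (3 - (j : ℂ) - 2 * k)
  have hw : ∀ j k k' : Fin 3, k ≠ j → k' ≠ j →
      ∑ s, w j k s * v k' s = if k' = k then 1 else 0 := by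
    intro j k k' hk hk'
    fin_cases j <;> fin_cases k <;> fin_cases k' <;> simp_all [w, v] <;> norm_num
  refine ⟨fun a t => if (e t).1 = a.2 then v a.1.compl (e t).2 else 0,
    fun j a t => if (e t).1 = a.1.2 then w j a.1.1.compl (e t).2 else 0, ?_⟩
  intro j a a'
  rw [e.sum_comp (fun x => (if x.1 = a.1.2 then w j a.1.1.compl x.2 else 0) *
    (if x.1 = a'.1.2 then v a'.1.1.compl x.2 else 0)), Fintype.sum_prod_type]
  have h1 := hw j a.1.1.compl a'.1.1.compl ((a.1.1.mem_iff j).1 a.2).symm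
    ((a'.1.1.mem_iff j).1 a'.2).symm
  rw [Finset.sum_eq_single a.1.2]
  · by_cases h2 : a'.1.2 = a.1.2
    · simp only [h2, if_true, h1, Pair.compl_injective.eq_iff, Prod.ext_iff, and_true]
    · have h3 : a'.1 ≠ a.1 := fun h => h2 (by rw [h])
      simp [Ne.symm h2, h3]
  · intro I _ hI
    simp [hI]
  · simp

/-- If the zero-forced channels to the desired receivers are invertible, then every message can be
sent interference free with `L` streams over six channel uses. -/
theorem nonempty_linearScheme_zeroForcing {M N L : ℕ} (hM : L ≤ M) (hN : L ≤ N) (h : Channel M N)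
    (hsub : ∀ j i, IsUnit (h.sub hM hN j i).det)
    (hzf : ∀ j k i i', j ≠ k → i ≠ i' → IsUnit (zeroForced h hM hN j k i i').det) :
    Nonempty (LinearScheme h 6 L) := by
  obtain ⟨u, φ, hu⟩ := exists_time_directions
  let W : Msg → Fin 3 → Matrix (Fin M) (Fin L) ℂ := fun a i =>
    if i = a.2.fst then firstCols M L hM * (h.sub hM hN a.1.compl i)⁻¹
    else if i = a.2.snd then -(firstCols M L hM * (h.sub hM hN a.1.compl i)⁻¹) else 0
  let G : Fin 3 → Msg → Matrix (Fin L) (Fin L) ℂ := fun j a =>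
    zeroForced h hM hN j a.1.compl a.2.fst a.2.snd
  have hG : ∀ j a, (firstCols N L hN).transpose * ∑ i, h.mat j i * W a i = G j a := by
    intro j a
    rw [← Finset.sum_subset (Finset.subset_univ {a.2.fst, a.2.snd}), Finset.sum_pair a.2.fst_ne_snd]
    · simp only [W, if_true, if_neg a.2.fst_ne_snd.symm, Matrix.mul_neg, ← sub_eq_add_neg,
        Matrix.mul_sub, G, zeroForced, ← firstCols_mat_firstCols, Matrix.mul_assoc]
    · intro i _ hi
      simp only [Finset.mem_insert, Finset.mem_singleton, not_or] at hi
      simp [W, hi.1, hi.2]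
  let Γ : Fin 3 → Msg → Matrix (Fin L) (Fin N) ℂ := fun j a =>
    (G j a)⁻¹ * (firstCols N L hN).transpose
  let V : Msg → Fin 3 → Matrix (Fin 6 × Fin M) (Fin L) ℂ := fun a i =>
    Matrix.of fun x l => u a x.1 * W a i x.2 l
  let F : (j : Fin 3) → Desired j → Matrix (Fin L) (Fin 6 × Fin N) ℂ := fun j a =>
    Matrix.of fun l x => φ j a x.1 * Γ j a.1 l x.2
  refine ⟨⟨V, ?_, F, ?_⟩⟩
  · intro a i hi
    rw [Pair.mem_iff_fst_snd, not_or] at hi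
    ext x l
    simp [V, W, hi.1, hi.2]
  · intro j a a'
    have h1 : F j a * effective h j (V a') =
        (∑ t, φ j a t * u a' t) • ((G j a.1)⁻¹ * G j a') := by
      rw [← hG j a', ← Matrix.mul_assoc]
      ext l l'
      rw [Matrix.mul_apply, Fintype.sum_prod_type, Matrix.smul_apply, Matrix.mul_apply, smul_eq_mul,
        Finset.sum_mul_sum]
      refine Finset.sum_congr rfl fun t _ => Finset.sum_congr rfl fun n _ => ?_
      rw [effective_apply, Matrix.sum_apply]
      change φ j a t * Γ j a.1 l n * _ = _ * (Γ j a.1 l n * _)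
      simp only [V, Matrix.mul_apply, Channel.mat, Matrix.of_apply, Finset.mul_sum]
      refine Finset.sum_congr rfl fun i _ => Finset.sum_congr rfl fun m _ => ?_
      ring
    rw [h1]
    by_cases hj : j ∈ a'.1.1
    · rw [hu j a ⟨a', hj⟩]
      dsimp only
      split_ifs with haa
      · rw [haa, Matrix.nonsing_inv_mul _ (hzf _ _ _ _ ((Pair.mem_iff _ _).1 a.2)
          (Pair.fst_ne_snd _)), one_smul]
      · rw [zero_smul]
    · rw [Pair.mem_iff, not_not] at hj
      have hne : a' ≠ a.1 := by
        rintro rfl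
        exact (Pair.mem_iff _ _).1 a.2 hj
      have h0 : G j a' = 0 := by
        simp only [G, zeroForced, hj]
        rw [Matrix.mul_nonsing_inv _ (hsub _ _), Matrix.mul_nonsing_inv _ (hsub _ _), sub_self]
      rw [if_neg hne, h0, Matrix.mul_zero, smul_zero]

theorem ae_nonempty_linearScheme_zeroForcing (ν : Measure ℂ) [IsProbabilityMeasure ν]
    [NullSingletonClass ν] {M N L : ℕ} (hM : L ≤ M) (hN : L ≤ N) :
    ∀ᵐ h ∂channelLaw ν M N, Nonempty (LinearScheme h 6 L) := by
  have h1 : ∀ᵐ h ∂channelLaw ν M N, ∀ j i, IsUnit (h.sub hM hN j i).det :=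
    ae_all_iff.2 fun j => ae_all_iff.2 fun i => ae_isUnit_det_sub ν hM hN j i
  have h2 : ∀ᵐ h ∂channelLaw ν M N, ∀ j k i i', j ≠ k → i ≠ i' →
      IsUnit (zeroForced h hM hN j k i i').det := by
    simp only [ae_all_iff]
    exact fun j k i i' hjk hii => ae_isUnit_det_zeroForced ν hM hN hjk hii
  filter_upwards [h1, h2] with h h1 h2
  exact nonempty_linearScheme_zeroForcing hM hN h h1 h2

/-! ### Decoding all messages -/

/-- The position `(r, m)` of a stream: its offset in time and its transmit antenna. -/
def streamPos {M L : ℕ} (hL : L ≤ 3 * M) (l : Fin L) : Fin 3 × Fin M :=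
  finProdFinEquiv.symm (Fin.castLE hL l)

/-- The square matrix through which receiver `j` sees the `L` streams sent in a slot of offset `s`,
when stream `l` comes from transmitter `s - r`. -/
def slotMatrix {M N L : ℕ} (hL : L ≤ 3 * M) (hN : L ≤ N) (h : Channel M N) (j s : Fin 3) :
    Matrix (Fin L) (Fin L) ℂ :=
  Matrix.of fun n l => h (j, s - (streamPos hL l).1, Fin.castLE hN n, (streamPos hL l).2)

theorem ae_isUnit_det_slotMatrix (ν : Measure ℂ) [IsProbabilityMeasure ν] [NullSingletonClass ν]
    {M N L : ℕ} (hL : L ≤ 3 * M) (hN : L ≤ N) (j s : Fin 3) :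
    ∀ᵐ h ∂channelLaw ν M N, IsUnit (slotMatrix hL hN h j s).det := by
  let A : Matrix (Fin L) (Fin L) (MvPolynomial (Fin 3 × Fin 3 × Fin N × Fin M) ℂ) :=
    Matrix.of fun n l => MvPolynomial.X
      (j, s - (streamPos hL l).1, Fin.castLE hN n, (streamPos hL l).2)
  have key : ∀ h : Channel M N, MvPolynomial.eval h A.det = (slotMatrix hL hN h j s).det := by
    intro h
    rw [RingHom.map_det]
    congr 1
    ext; simp [A, slotMatrix]
  have := ae_channelLaw_eval_ne_zero ν A.det
    (fun x => if (finProdFinEquiv (s - x.2.1, x.2.2.2)).val = x.2.2.1.val then 1 else 0) (by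
      rw [key]
      have : slotMatrix hL hN (fun x : Fin 3 × Fin 3 × Fin N × Fin M =>
          if (finProdFinEquiv (s - x.2.1, x.2.2.2)).val = x.2.2.1.val then (1 : ℂ) else 0) j s
          = 1 := by
        ext n m
        simp only [slotMatrix, streamPos, Matrix.of_apply, sub_sub_cancel, Prod.mk.eta,
          Equiv.apply_symm_apply, Fin.val_castLE, Matrix.one_apply, Fin.ext_iff, eq_comm]
      rw [this, Matrix.det_one]
      exact one_ne_zero)
  filter_upwards [this] with h hh
  rw [key] at hh
  exact hh.isUnit

theorem exists_injective_mem : ∃ f : Pair → Fin 3, Function.Injective f ∧ ∀ I, f I ∈ I.1 := by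
  have h : ∀ I : Pair, I.compl + 1 ∈ I.1 := by
    intro I
    rw [Pair.mem_iff]
    generalize I.compl = k
    revert k
    decide
  exact ⟨fun I => I.compl + 1, fun I I' hI => Pair.compl_injective (add_right_cancel hI), h⟩

/-- If the slot matrices are invertible, then each receiver can decode all messages, with `L`
streams each over nine channel uses. -/
theorem nonempty_linearScheme_decodeAll {M N L : ℕ} (hL : L ≤ 3 * M) (hN : L ≤ N) (h : Channel M N)
    (hs : ∀ j s, IsUnit (slotMatrix hL hN h j s).det) : Nonempty (LinearScheme h 9 L) := by
  obtain ⟨f, hf, hmem⟩ := exists_injective_mem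
  let e : Fin 9 ≃ Pair × Fin 3 := (Fintype.equivFinOfCardEq (by decide)).symm
  let r : Fin L → Fin 3 := fun l => (streamPos hL l).1
  let m : Fin L → Fin M := fun l => (streamPos hL l).2
  let Γ : Fin 3 → Fin 3 → Matrix (Fin L) (Fin N) ℂ := fun j s =>
    (slotMatrix hL hN h j s)⁻¹ * (firstCols N L hN).transpose
  have hΓ : ∀ j s l l', ∑ n, Γ j s l n * h (j, s - r l', n, m l') = if l = l' then 1 else 0 := by
    intro j s l l'
    have h1 := Matrix.nonsing_inv_mul _ (hs j s)
    have h2 : slotMatrix hL hN h j s = (firstCols N L hN).transpose *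
        Matrix.of fun n l' => h (j, s - r l', n, m l') := by
      rw [firstCols_transpose_mul]
      rfl
    nth_rewrite 2 [h2] at h1
    rw [← Matrix.mul_assoc] at h1
    have := congrFun (congrFun h1 l) l'
    rwa [Matrix.mul_apply, Matrix.one_apply] at this
  refine ⟨⟨fun a i => Matrix.of fun x l =>
      if i = f a.2 ∧ x.2 = m l ∧ e x.1 = (a.1, r l + f a.2) then 1 else 0, ?_,
    fun j a => Matrix.of fun l x =>
      if e x.1 = (a.1.1, r l + f a.1.2) then Γ j (r l + f a.1.2) l x.2 else 0, ?_⟩⟩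
  · intro a i hi
    ext x l
    have : i ≠ f a.2 := fun h => hi (h ▸ hmem _)
    simp [this]
  · intro j a a'
    ext l l'
    have heff : ∀ t n, effective h j (fun i => Matrix.of fun (x : Fin 9 × Fin M) l =>
        if i = f a'.2 ∧ x.2 = m l ∧ e x.1 = (a'.1, r l + f a'.2) then (1 : ℂ) else 0) (t, n) l' =
        if e t = (a'.1, r l' + f a'.2) then h (j, f a'.2, n, m l') else 0 := by
      intro t n
      rw [effective_apply, Finset.sum_eq_single (f a'.2), Finset.sum_eq_single (m l')]
      · simp
      · intro x _ hx
        simp [hx]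
      · simp
      · intro x _ hx
        simp [hx]
      · simp
    rw [Matrix.mul_apply, Fintype.sum_prod_type]
    simp only [heff, Matrix.of_apply]
    rw [← e.symm.sum_comp]
    simp only [Equiv.apply_symm_apply]
    rw [Finset.sum_eq_single (a.1.1, r l + f a.1.2)]
    · by_cases heq : (a.1.1, r l + f a.1.2) = (a'.1, r l' + f a'.2)
      · simp only [heq, if_true]
        have h1 : a.1.1 = a'.1 := (Prod.ext_iff.1 heq).1
        have h2 : r l + f a.1.2 = r l' + f a'.2 := (Prod.ext_iff.1 heq).2
        rw [h2]
        have h3 := hΓ j (r l' + f a'.2) l l'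
        rw [add_sub_cancel_left] at h3
        rw [h3]
        by_cases hl : l = l'
        · subst hl
          have h4 : a' = a.1 := Prod.ext h1.symm (hf (add_left_cancel h2).symm)
          simp [h4]
        · by_cases h4 : a' = a.1 <;> simp [h4, hl]
      · simp only [if_neg heq, mul_zero, Finset.sum_const_zero]
        by_cases h4 : a' = a.1
        · have hl : l ≠ l' := by
            rintro rfl
            exact heq (by rw [h4])
          simp [h4, hl]
        · simp [h4]
    · intro x _ hx
      simp [hx]
    · simp

theorem ae_nonempty_linearScheme_decodeAll (ν : Measure ℂ) [IsProbabilityMeasure ν]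
    [NullSingletonClass ν] {M N L : ℕ} (hL : L ≤ 3 * M) (hN : L ≤ N) :
    ∀ᵐ h ∂channelLaw ν M N, Nonempty (LinearScheme h 9 L) := by
  have h1 : ∀ᵐ h ∂channelLaw ν M N, ∀ j s, IsUnit (slotMatrix hL hN h j s).det :=
    ae_all_iff.2 fun j => ae_all_iff.2 fun s => ae_isUnit_det_slotMatrix ν hL hN j s
  filter_upwards [h1] with h h1
  exact nonempty_linearScheme_decodeAll hL hN h h1

theorem linearDoFAchievable_d₁₂ (ν : Measure ℂ) [IsProbabilityMeasure ν] [NullSingletonClass ν]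
    {M N : ℕ} (hM : 0 < M) : LinearDoFAchievable ν M N (d₁₂ M N) := by
  have hM' : (0 : ℝ) < M := by exact_mod_cast hM
  unfold d₁₂
  split_ifs with h1 h2 h3
  · rw [div_le_one hM'] at h1
    exact ⟨6, N, by norm_num, by push_cast; ring,
      ae_nonempty_linearScheme_zeroForcing ν (by exact_mod_cast h1) le_rfl⟩
  · rw [not_le, one_lt_div hM'] at h1
    exact ⟨6, M, by norm_num, by push_cast; ring,
      ae_nonempty_linearScheme_zeroForcing ν le_rfl (by exact_mod_cast h1.le)⟩
  · rw [div_le_iff₀ hM'] at h3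
    exact ⟨9, N, by norm_num, by push_cast; ring,
      ae_nonempty_linearScheme_decodeAll ν (by exact_mod_cast h3) le_rfl⟩
  · rw [not_le, lt_div_iff₀ hM'] at h3
    exact ⟨9, 3 * M, by norm_num, by push_cast; ring,
      ae_nonempty_linearScheme_decodeAll ν le_rfl (by exact_mod_cast h3.le)⟩

/-! ### Block codes of large minimum distance -/

theorem card_hammingBall_le {A : Type*} [Fintype A] [DecidableEq A] [Nonempty A] {n : ℕ}
    (x : Fin n → A) (D : ℕ) :
    (Finset.univ.filter fun y => hammingDist x y ≤ D).card ≤ 2 ^ n * Fintype.card A ^ D := by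
  let cyl : Finset (Fin n) → Finset (Fin n → A) := fun S =>
    Fintype.piFinset fun i => if i ∈ S then Finset.univ else {x i}
  have hcyl : ∀ S, (cyl S).card = Fintype.card A ^ S.card := by
    intro S
    simp only [cyl, Fintype.card_piFinset, apply_ite Finset.card, Finset.card_univ,
      Finset.card_singleton]
    rw [Finset.prod_ite_mem, Finset.univ_inter, Finset.prod_const]
  have hsub : (Finset.univ.filter fun y => hammingDist x y ≤ D) ⊆
      ((Finset.univ : Finset (Finset (Fin n))).filter fun S => S.card ≤ D).biUnion cyl := by
    intro y hy
    simp only [Finset.mem_filter, Finset.mem_univ, true_and] at hy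
    simp only [Finset.mem_biUnion, Finset.mem_filter, Finset.mem_univ, true_and]
    refine ⟨Finset.univ.filter fun i => x i ≠ y i, hy, ?_⟩
    simp only [cyl, Fintype.mem_piFinset, Finset.mem_filter, Finset.mem_univ, true_and]
    intro i
    by_cases hi : x i = y i <;> simp [hi]
  refine (Finset.card_le_card hsub).trans ((Finset.card_biUnion_le_card_mul _ _
    (Fintype.card A ^ D) fun S hS => ?_).trans ?_)
  · rw [hcyl]
    exact Nat.pow_le_pow_right Fintype.card_pos (Finset.mem_filter.1 hS).2
  · refine Nat.mul_le_mul_right _ ((Finset.card_le_univ _).trans ?_)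
    simp

/-- The Gilbert–Varshamov bound, with a crude estimate of the volume of a Hamming ball. -/
theorem exists_code_hammingDist (A : Type*) [Fintype A] [DecidableEq A] [Nonempty A] (n D : ℕ) :
    ∃ C : Finset (Fin n → A), (∀ x ∈ C, ∀ y ∈ C, x ≠ y → D < hammingDist x y) ∧
      Fintype.card A ^ n ≤ C.card * (2 ^ n * Fintype.card A ^ D) := by
  obtain ⟨C, hC, hmax⟩ := Finset.exists_max_image
    ((Finset.univ : Finset (Finset (Fin n → A))).filter fun C =>
      ∀ x ∈ C, ∀ y ∈ C, x ≠ y → D < hammingDist x y) Finset.card ⟨∅, by simp⟩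
  simp only [Finset.mem_filter, Finset.mem_univ, true_and] at hC hmax
  refine ⟨C, hC, ?_⟩
  have hcover : (Finset.univ : Finset (Fin n → A)) ⊆
      C.biUnion fun x => Finset.univ.filter fun y => hammingDist x y ≤ D := by
    intro y _
    simp only [Finset.mem_biUnion, Finset.mem_filter, Finset.mem_univ, true_and]
    by_contra! hy
    have hyC : y ∉ C := fun h => absurd (hy y h) (by simp)
    have := hmax (insert y C) (by
      intro x hx x' hx' hne
      rcases Finset.mem_insert.1 hx with h | h
      · rcases Finset.mem_insert.1 hx' with h' | h'
        · exact absurd (h.trans h'.symm) hne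
        · rw [h, hammingDist_comm]
          exact hy x' h'
      · rcases Finset.mem_insert.1 hx' with h' | h'
        · rw [h']
          exact hy x h
        · exact hC x h x' h' hne)
    rw [Finset.card_insert_of_notMem hyC] at this
    omega
  have h1 := (Finset.card_le_card hcover).trans
    (Finset.card_biUnion_le_card_mul _ _ _ fun x _ => card_hammingBall_le x D)
  simpa using h1

/-- Decoding to a codeword within distance `r` of the received word. -/
def decodeWithin {A : Type*} [DecidableEq A] {n K : ℕ} (hK : 0 < K) (c : Fin K → Fin n → A)
    (r : ℕ) (y : Fin n → A) : Fin K :=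
  open Classical in
  if h : ∃ k, hammingDist (c k) y ≤ r then h.choose else ⟨0, hK⟩

theorem decodeWithin_eq {A : Type*} [DecidableEq A] {n K : ℕ} (hK : 0 < K) {c : Fin K → Fin n → A}
    {r : ℕ} (hc : ∀ k k', k ≠ k' → 2 * r < hammingDist (c k) (c k')) {k : Fin K} {y : Fin n → A}
    (hy : hammingDist (c k) y ≤ r) : decodeWithin hK c r y = k := by
  have h : ∃ k, hammingDist (c k) y ≤ r := ⟨k, hy⟩
  rw [decodeWithin, dif_pos h]
  by_contra hne
  have h1 := hc _ _ hne
  have h2 := hammingDist_triangle_right (c h.choose) (c k) y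
  have h3 := h.choose_spec
  omega

/-! ### Quadrature amplitude modulation -/

/-- The square constellation with `Q ^ 2` points at spacing `Δ`. -/
def qam (Δ : ℝ) {Q : ℕ} (x : Fin Q × Fin Q) : ℂ := ⟨Δ * x.1, Δ * x.2⟩

/-- Rounding of a real number to the points `0, Δ, …, (Q - 1) Δ`. -/
def roundTo (Δ : ℝ) {Q : ℕ} (hQ : 0 < Q) (y : ℝ) : Fin Q :=
  ⟨min ⌊y / Δ + 1 / 2⌋₊ (Q - 1), by omega⟩

theorem measurable_roundTo (Δ : ℝ) {Q : ℕ} (hQ : 0 < Q) : Measurable (roundTo Δ hQ) := by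
  let g : ℕ → Fin Q := fun m => ⟨min m (Q - 1), by omega⟩
  have hg : Measurable g := Measurable.of_discrete
  exact hg.comp (Nat.measurable_floor.comp (by fun_prop))

theorem roundTo_add {Δ : ℝ} (hΔ : 0 < Δ) {Q : ℕ} (hQ : 0 < Q) (x : Fin Q) {e : ℝ}
    (he : |e| < Δ / 2) : roundTo Δ hQ (Δ * x + e) = x := by
  have h1 : (Δ * x + e) / Δ + 1 / 2 = x + (e / Δ + 1 / 2) := by
    field_simp
    ring
  rw [abs_lt] at he
  have h2 : -(1 / 2) < e / Δ := by
    rw [lt_div_iff₀ hΔ]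
    linarith [he.1]
  have h3 : e / Δ < 1 / 2 := by
    rw [div_lt_iff₀ hΔ]
    linarith [he.2]
  have h4 : ⌊(Δ * x + e) / Δ + 1 / 2⌋₊ = (x : ℕ) := by
    rw [h1, Nat.floor_eq_iff (by linarith [(Nat.cast_nonneg (x : ℕ) : (0 : ℝ) ≤ (x : ℕ))])]
    constructor <;> linarith
  apply Fin.ext
  simp only [roundTo, h4]
  omega

/-- The nearest point of the constellation. -/
def quantize (Δ : ℝ) {Q : ℕ} (hQ : 0 < Q) (y : ℂ) : Fin Q × Fin Q :=
  (roundTo Δ hQ y.re, roundTo Δ hQ y.im)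

theorem measurable_quantize (Δ : ℝ) {Q : ℕ} (hQ : 0 < Q) : Measurable (quantize Δ hQ) :=
  ((measurable_roundTo Δ hQ).comp Complex.measurable_re).prodMk
    ((measurable_roundTo Δ hQ).comp Complex.measurable_im)

theorem quantize_qam_add {Δ : ℝ} (hΔ : 0 < Δ) {Q : ℕ} (hQ : 0 < Q) (x : Fin Q × Fin Q) {e : ℂ}
    (he : ‖e‖ < Δ / 2) : quantize Δ hQ (qam Δ x + e) = x :=
  Prod.ext (roundTo_add hΔ hQ x.1 ((Complex.abs_re_le_norm e).trans_lt he))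
    (roundTo_add hΔ hQ x.2 ((Complex.abs_im_le_norm e).trans_lt he))

theorem norm_qam_le {Δ : ℝ} (hΔ : 0 < Δ) {Q : ℕ} (x : Fin Q × Fin Q) :
    ‖qam Δ x‖ ≤ 2 * Δ * Q := by
  have h1 : ((x.1 : ℕ) : ℝ) ≤ Q := by exact_mod_cast x.1.2.le
  have h2 : ((x.2 : ℕ) : ℝ) ≤ Q := by exact_mod_cast x.2.2.le
  refine (Complex.norm_le_abs_re_add_abs_im _).trans ?_
  simp only [qam]
  rw [abs_of_nonneg (by positivity), abs_of_nonneg (by positivity)]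
  nlinarith

/-! ### Noise over blocks -/

instance : IsProbabilityMeasure complexGaussian :=
  Measure.isProbabilityMeasure_map Complex.measurableEquivRealProd.symm.measurable.aemeasurable

instance (T N : ℕ) : IsProbabilityMeasure (noise T N) := by
  unfold noise
  infer_instance

theorem pi_map_comp_injective {E ι κ : Type*} [MeasurableSpace E] [Fintype ι] [Fintype κ]
    (μ : Measure E) [IsProbabilityMeasure μ] {e : κ → ι} (he : Function.Injective e) :
    (Measure.pi fun _ : ι => μ).map (fun z k => z (e k)) = Measure.pi fun _ : κ => μ := by
  have h := (iIndepFun_pi (μ := fun _ : ι => μ) (X := fun _ x => x)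
    fun _ => aemeasurable_id).precomp he
  rw [iIndepFun_iff_map_fun_eq_pi_map fun k => (measurable_pi_apply (e k)).aemeasurable] at h
  rw [h]
  congr 1
  ext1 k
  exact (measurePreserving_eval (fun _ : ι => μ) (e k)).map_eq

/-- Chebyshev's inequality for the number of blocks of an i.i.d. sequence that lie in `B`. -/
theorem measureReal_card_blocks_le {E : Type*} [MeasurableSpace E] (μ : Measure E)
    [IsProbabilityMeasure μ] {T n T₀ : ℕ} (hn : 0 < n) {e : Fin n × Fin T₀ → Fin T}
    (he : Function.Injective e) {B : Set (Fin T₀ → E)} [DecidablePred (· ∈ B)]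
    (hB : MeasurableSet B) {δ : ℝ} (hδ : (Measure.pi fun _ : Fin T₀ => μ).real B < δ) :
    (Measure.pi fun _ : Fin T => μ).real {z | δ * n ≤
      ((Finset.univ.filter fun τ : Fin n => (fun t => z (e (τ, t))) ∈ B).card : ℝ)} ≤
      1 / (4 * n * (δ - (Measure.pi fun _ : Fin T₀ => μ).real B) ^ 2) := by
  set p := (Measure.pi fun _ : Fin T₀ => μ).real B with hp
  set ρ := (Measure.pi fun _ : Fin T => μ) with hρ
  let blk : Fin n → (Fin T → E) → (Fin T₀ → E) := fun τ z t => z (e (τ, t))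
  have hblk : ∀ τ, Measurable (blk τ) := fun τ => by
    exact measurable_pi_lambda _ fun t => measurable_pi_apply _
  let ind : (Fin T₀ → E) → ℝ := B.indicator 1
  have hind : Measurable ind := measurable_one.indicator hB
  let X : Fin n → (Fin T → E) → ℝ := fun τ z => ind (blk τ z)
  have hX : ∀ τ, Measurable (X τ) := fun τ => hind.comp (hblk τ)
  have hX01 : ∀ τ z, X τ z ∈ Set.Icc (0 : ℝ) 1 := by
    intro τ z
    simp only [X, ind, Set.indicator_apply, Pi.one_apply]
    split_ifs <;> simp
  have hmem : ∀ τ, MemLp (X τ) 2 ρ := fun τ =>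
    MemLp.of_bound (hX τ).aestronglyMeasurable 1 (ae_of_all _ fun z => by
      rw [Real.norm_eq_abs, abs_of_nonneg (hX01 τ z).1]
      exact (hX01 τ z).2)
  have hint : ∀ τ, ∫ z, X τ z ∂ρ = p := by
    intro τ
    have hinj : Function.Injective fun t : Fin T₀ => e (τ, t) :=
      fun t t' h => (Prod.ext_iff.1 (he h)).2
    have h1 : ∫ z, X τ z ∂ρ = ∫ x, ind x ∂(ρ.map (blk τ)) :=
      (integral_map (hblk τ).aemeasurable hind.aestronglyMeasurable).symm
    rw [h1, pi_map_comp_injective μ hinj]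
    exact integral_indicator_one hB
  have hpair : Set.Pairwise (↑(Finset.univ : Finset (Fin n))) fun τ τ' => X τ ⟂ᵢ[ρ] X τ' := by
    intro τ _ τ' _ hne
    have hind' := iIndepFun_pi (μ := fun _ : Fin T => μ) (X := fun _ x => x)
      fun _ => aemeasurable_id
    let S : Fin n → Finset (Fin T) := fun τ => Finset.univ.image fun t => e (τ, t)
    have hS : ∀ τ t, e (τ, t) ∈ S τ := fun τ t => Finset.mem_image_of_mem _ (Finset.mem_univ t)
    have hdis : Disjoint (S τ) (S τ') := by
      rw [Finset.disjoint_left]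
      intro t ht ht'
      obtain ⟨s, -, hs⟩ := Finset.mem_image.1 ht
      obtain ⟨s', -, hs'⟩ := Finset.mem_image.1 ht'
      exact hne (Prod.ext_iff.1 (he (hs.trans hs'.symm))).1
    have h1 := hind'.indepFun_finset (S τ) (S τ') hdis fun i => measurable_pi_apply i
    have h2 : ∀ σ, Measurable fun (x : S σ → E) (t : Fin T₀) => x ⟨e (σ, t), hS σ t⟩ :=
      fun σ => measurable_pi_lambda _ fun t => measurable_pi_apply _
    exact h1.comp (hind.comp (h2 τ)) (hind.comp (h2 τ'))
  have hvar : Var[∑ τ, X τ; ρ] ≤ n / 4 := by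
    rw [IndepFun.variance_sum (fun τ _ => hmem τ) hpair]
    have : ∀ τ ∈ (Finset.univ : Finset (Fin n)), Var[X τ; ρ] ≤ 1 / 4 := by
      intro τ _
      refine (variance_le_sq_of_bounded (ae_of_all _ (hX01 τ)) (hX τ).aemeasurable).trans ?_
      norm_num
    refine (Finset.sum_le_sum this).trans ?_
    simp only [Finset.sum_const, Finset.card_univ, Fintype.card_fin, nsmul_eq_mul]
    linarith
  have hmean : ∫ z, (∑ τ, X τ) z ∂ρ = n * p := by
    simp only [Finset.sum_apply]
    rw [integral_finsetSum _ fun τ _ => (hmem τ).integrable (by norm_num)]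
    simp [hint]
  have hn' : (0 : ℝ) < n := by exact_mod_cast hn
  have hc : 0 < (δ - p) * n := mul_pos (sub_pos.2 hδ) hn'
  have hcheb := meas_ge_le_variance_div_sq (memLp_finsetSum' Finset.univ fun τ _ => hmem τ) hc
  rw [hmean] at hcheb
  have hsub : {z | δ * n ≤
      ((Finset.univ.filter fun τ : Fin n => (fun t => z (e (τ, t))) ∈ B).card : ℝ)} ⊆
      {z | (δ - p) * n ≤ |(∑ τ, X τ) z - n * p|} := by
    intro z hz
    have hcard : (∑ τ, X τ) z =
        ((Finset.univ.filter fun τ : Fin n => (fun t => z (e (τ, t))) ∈ B).card : ℝ) := by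
      simp only [Finset.sum_apply, X, ind, blk, Set.indicator_apply, Pi.one_apply]
      rw [Finset.sum_boole]
    have hz' : δ * n ≤ (∑ τ, X τ) z := by
      rw [hcard]
      exact hz
    exact le_trans (by linarith) (le_abs_self ((∑ τ, X τ) z - n * p))
  refine (measureReal_mono hsub).trans ?_
  refine (ENNReal.toReal_le_of_le_ofReal (div_nonneg (variance_nonneg _ _) (sq_nonneg _)) hcheb).trans ?_
  have h2 : 0 < δ - p := sub_pos.2 hδ
  calc Var[∑ τ, X τ; ρ] / ((δ - p) * n) ^ 2 ≤ (n / 4) / ((δ - p) * n) ^ 2 := by gcongr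
    _ = 1 / (4 * n * (δ - p) ^ 2) := by
      field_simp

theorem tendsto_measureReal_le_atTop {Ω : Type*} [MeasurableSpace Ω] (μ : Measure Ω)
    [IsFiniteMeasure μ] {g : Ω → ℝ} (hg : Measurable g) :
    Tendsto (fun c : ℝ => μ.real {z | c ≤ g z}) atTop (𝓝 0) := by
  have h := tendsto_measure_iInter_atTop (μ := μ) (s := fun c : ℝ => {z | c ≤ g z})
    (fun c => (measurableSet_le measurable_const hg).nullMeasurableSet)
    (fun c c' hc z hz => le_trans hc hz) ⟨0, measure_ne_top _ _⟩
  have h0 : ⋂ c : ℝ, {z | c ≤ g z} = ∅ := by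
    ext z
    simp only [Set.mem_iInter, Set.mem_ofPred_eq, Set.mem_empty_iff_false, iff_false, not_forall,
      not_le]
    exact exists_gt (g z)
  rw [h0, measure_empty] at h
  exact (ENNReal.tendsto_toReal ENNReal.zero_ne_top).comp h

/-! ### Coding over a linear scheme -/

section Block

variable {M N T₀ b : ℕ} {h : Channel M N}

/-- The signal of transmitter `i` over a block, when the linear scheme carries the symbols `s`. -/
def LinearScheme.blockInput (S : LinearScheme h T₀ b) (s : Msg → Fin b → ℂ) (i : Fin 3)
    (t : Fin T₀) (m : Fin M) : ℂ :=
  ∑ a, (S.precoder a i).mulVec (s a) (t, m)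

/-- The symbols of a desired message, as linearly recovered by receiver `j` over a block. -/
def LinearScheme.filtered (S : LinearScheme h T₀ b) (j : Fin 3) (a : Desired j)
    (y : Fin T₀ → Fin N → ℂ) : Fin b → ℂ :=
  (S.filter j a).mulVec fun x => y x.1 x.2

theorem LinearScheme.blockInput_congr (S : LinearScheme h T₀ b) {s s' : Msg → Fin b → ℂ}
    {i : Fin 3} (hs : ∀ a : Msg, i ∈ a.2.1 → s a = s' a) : S.blockInput s i = S.blockInput s' i := by
  ext t m
  refine Finset.sum_congr rfl fun a _ => ?_
  by_cases hi : i ∈ a.2.1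
  · rw [hs a hi]
  · simp [S.precoder_local a i hi]

theorem LinearScheme.filtered_received (S : LinearScheme h T₀ b) (s : Msg → Fin b → ℂ) (j : Fin 3)
    (a : Desired j) (z : Fin T₀ → Fin N → ℂ) :
    S.filtered j a (received h j (S.blockInput s) z) = s a.1 + S.filtered j a z := by
  have h1 : (fun x : Fin T₀ × Fin N => received h j (S.blockInput s) z x.1 x.2) =
      ∑ a', (effective h j (S.precoder a')).mulVec (s a') + fun x => z x.1 x.2 := by
    ext ⟨t, n⟩
    simp only [received, Pi.add_apply, Finset.sum_apply, Matrix.mulVec, dotProduct,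
      effective_apply, LinearScheme.blockInput, Channel.mat, Matrix.of_apply, Finset.sum_mul,
      Finset.mul_sum]
    congr 1
    calc _ = ∑ i, ∑ a', ∑ m, ∑ l, h (j, i, n, m) * (S.precoder a' i (t, m) l * s a' l) :=
          Finset.sum_congr rfl fun i _ => Finset.sum_comm
      _ = ∑ a', ∑ i, ∑ m, ∑ l, h (j, i, n, m) * (S.precoder a' i (t, m) l * s a' l) :=
          Finset.sum_comm
      _ = ∑ a', ∑ i, ∑ l, ∑ m, h (j, i, n, m) * (S.precoder a' i (t, m) l * s a' l) :=
          Finset.sum_congr rfl fun a' _ => Finset.sum_congr rfl fun i _ => Finset.sum_comm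
      _ = ∑ a', ∑ l, ∑ i, ∑ m, h (j, i, n, m) * (S.precoder a' i (t, m) l * s a' l) :=
          Finset.sum_congr rfl fun a' _ => Finset.sum_comm
      _ = _ := by simp only [mul_assoc]
  rw [LinearScheme.filtered, h1, Matrix.mulVec_add, Matrix.mulVec_sum]
  congr 1
  simp only [Matrix.mulVec_mulVec, S.recovers]
  rw [Finset.sum_eq_single a.1]
  · simp
  · intro a' _ ha'
    simp [ha']
  · simp

/-- The total gain of the precoders of a linear scheme. -/
def LinearScheme.gain (S : LinearScheme h T₀ b) : ℝ :=
  1 + ∑ i, ∑ t, ∑ m, ∑ a, ∑ l, ‖S.precoder a i (t, m) l‖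

theorem LinearScheme.gain_pos (S : LinearScheme h T₀ b) : 0 < S.gain := by
  unfold LinearScheme.gain
  positivity

theorem LinearScheme.power_blockInput_le (S : LinearScheme h T₀ b) {s : Msg → Fin b → ℂ} {B : ℝ}
    (hB : 0 ≤ B) (hs : ∀ a l, ‖s a l‖ ≤ B) (i : Fin 3) (t : Fin T₀) :
    ∑ m, ‖S.blockInput s i t m‖ ^ 2 ≤ (S.gain * B) ^ 2 := by
  refine (Finset.sum_sq_le_sq_sum_of_nonneg fun m _ => norm_nonneg _).trans ?_
  refine pow_le_pow_left₀ (Finset.sum_nonneg fun m _ => norm_nonneg _) ?_ 2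
  have h1 : ∀ m, ‖S.blockInput s i t m‖ ≤ (∑ a, ∑ l, ‖S.precoder a i (t, m) l‖) * B := by
    intro m
    rw [Finset.sum_mul]
    refine (norm_sum_le _ _).trans (Finset.sum_le_sum fun a _ => ?_)
    rw [Matrix.mulVec, dotProduct, Finset.sum_mul]
    refine (norm_sum_le _ _).trans (Finset.sum_le_sum fun l _ => ?_)
    rw [norm_mul]
    exact mul_le_mul_of_nonneg_left (hs a l) (norm_nonneg _)
  refine (Finset.sum_le_sum fun m _ => h1 m).trans ?_
  rw [← Finset.sum_mul]
  refine mul_le_mul_of_nonneg_right ?_ hB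
  have h2 : ∑ m, ∑ a, ∑ l, ‖S.precoder a i (t, m) l‖ ≤
      ∑ t, ∑ m, ∑ a, ∑ l, ‖S.precoder a i (t, m) l‖ :=
    Finset.single_le_sum (f := fun t => ∑ m, ∑ a, ∑ l, ‖S.precoder a i (t, m) l‖)
      (fun t _ => by positivity) (Finset.mem_univ t)
  have h3 : ∑ t, ∑ m, ∑ a, ∑ l, ‖S.precoder a i (t, m) l‖ ≤
      ∑ i, ∑ t, ∑ m, ∑ a, ∑ l, ‖S.precoder a i (t, m) l‖ :=
    Finset.single_le_sum (f := fun i => ∑ t, ∑ m, ∑ a, ∑ l, ‖S.precoder a i (t, m) l‖)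
      (fun i _ => by positivity) (Finset.mem_univ i)
  unfold LinearScheme.gain
  linarith

theorem LinearScheme.measurable_filtered (S : LinearScheme h T₀ b) (j : Fin 3) (a : Desired j) :
    Measurable (S.filtered j a) := by
  refine measurable_pi_lambda _ fun l => ?_
  simp only [LinearScheme.filtered, Matrix.mulVec, dotProduct]
  fun_prop

/-- The size of the noise in the symbols recovered by receiver `j` over a block. -/
def LinearScheme.noiseSize (S : LinearScheme h T₀ b) (j : Fin 3) (z : Fin T₀ → Fin N → ℂ) : ℝ :=
  ∑ a : Desired j, ∑ l, ‖S.filtered j a z l‖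

theorem LinearScheme.norm_filtered_le (S : LinearScheme h T₀ b) (j : Fin 3) (a : Desired j)
    (z : Fin T₀ → Fin N → ℂ) (l : Fin b) : ‖S.filtered j a z l‖ ≤ S.noiseSize j z :=
  (Finset.single_le_sum (f := fun l => ‖S.filtered j a z l‖) (fun _ _ => norm_nonneg _)
    (Finset.mem_univ l)).trans
  (Finset.single_le_sum (f := fun a : Desired j => ∑ l, ‖S.filtered j a z l‖)
    (fun _ _ => Finset.sum_nonneg fun _ _ => norm_nonneg _) (Finset.mem_univ a))

theorem LinearScheme.measurable_noiseSize (S : LinearScheme h T₀ b) (j : Fin 3) :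
    Measurable (S.noiseSize j) :=
  Finset.measurable_fun_sum _ fun a _ => Finset.measurable_fun_sum _ fun l _ =>
    ((measurable_pi_apply l).comp (S.measurable_filtered j a)).norm

/-- A bound, for all receivers, on the probability that symbols at spacing `Δ` are confused. -/
def LinearScheme.confusion (S : LinearScheme h T₀ b) (Δ : ℝ) : ℝ :=
  ∑ j, (noise T₀ N).real {z | Δ / 2 ≤ S.noiseSize j z}

theorem LinearScheme.tendsto_confusion (S : LinearScheme h T₀ b) :
    Tendsto S.confusion atTop (𝓝 0) := by
  have : Tendsto S.confusion atTop (𝓝 (∑ _j : Fin 3, (0 : ℝ))) :=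
    tendsto_finsetSum _ fun j _ =>
      (tendsto_measureReal_le_atTop (noise T₀ N) (S.measurable_noiseSize j)).comp
        (tendsto_id.atTop_div_const two_pos)
  simpa using this

theorem LinearScheme.le_confusion (S : LinearScheme h T₀ b) (Δ : ℝ) (j : Fin 3) :
    (noise T₀ N).real {z | Δ / 2 ≤ S.noiseSize j z} ≤ S.confusion Δ :=
  Finset.single_le_sum (f := fun j => (noise T₀ N).real {z | Δ / 2 ≤ S.noiseSize j z})
    (fun _ _ => measureReal_nonneg) (Finset.mem_univ j)

theorem LinearScheme.confusion_nonneg (S : LinearScheme h T₀ b) (Δ : ℝ) : 0 ≤ S.confusion Δ :=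
  Finset.sum_nonneg fun _ _ => measureReal_nonneg

/-- The channel use `t` of the block `τ`. -/
def blockTime {n T₀ T : ℕ} (hT : n * T₀ ≤ T) (x : Fin n × Fin T₀) : Fin T :=
  Fin.castLE hT (finProdFinEquiv x)

theorem blockTime_injective {n T₀ T : ℕ} (hT : n * T₀ ≤ T) :
    Function.Injective (blockTime hT : Fin n × Fin T₀ → Fin T) :=
  (Fin.castLE_injective hT).comp finProdFinEquiv.injective

open Classical in
/-- A code for modulated symbols of large minimum distance, sent block by block through a linear
scheme, is decoded correctly if the noise is large in at most `r` blocks. -/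
theorem LinearScheme.exists_code (S : LinearScheme h T₀ b) {n T K Q r : ℕ} {Δ P : ℝ}
    (hT : n * T₀ ≤ T) (hQ : 0 < Q) (hΔ : 0 < Δ) (hP : (S.gain * (2 * Δ * Q)) ^ 2 ≤ P) (hK : 0 < K)
    (c : Fin K → Fin n → Fin b → Fin Q × Fin Q)
    (hc : ∀ k k', k ≠ k' → 2 * r < hammingDist (c k) (c k')) :
    ∃ C : Code M N T K P, ∀ j, C.errorProb h j ≤ (noise T N).real {z | r <
      (Finset.univ.filter fun τ : Fin n =>
        (fun t => z (blockTime hT (τ, t))) ∈ {z | Δ / 2 ≤ S.noiseSize j z}).card} := by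
  let sym : (Msg → Fin K) → Fin n → Msg → Fin b → ℂ := fun w τ a l => qam Δ (c (w a) τ l)
  let enc : Fin 3 → (Msg → Fin K) → Fin T → Fin M → ℂ := fun i w =>
    Function.extend (blockTime hT) (fun x => S.blockInput (sym w x.1) i x.2) 0
  let word : (j : Fin 3) → Desired j → (Fin T → Fin N → ℂ) → Fin n → Fin b → Fin Q × Fin Q :=
    fun j a y τ l => quantize Δ hQ (S.filtered j a (fun t => y (blockTime hT (τ, t))) l)
  have henc : ∀ i w x, enc i w (blockTime hT x) = S.blockInput (sym w x.1) i x.2 :=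
    fun i w x => (blockTime_injective hT).extend_apply _ _ _
  have hword : ∀ j a, Measurable (word j a) := by
    intro j a
    refine measurable_pi_lambda _ fun τ => measurable_pi_lambda _ fun l => ?_
    have hblk : Measurable fun (y : Fin T → Fin N → ℂ) (t : Fin T₀) => y (blockTime hT (τ, t)) :=
      measurable_pi_lambda _ fun t => measurable_pi_apply _
    have hfil := (S.measurable_filtered j a).comp hblk
    exact (measurable_quantize Δ hQ).comp ((measurable_pi_apply l).comp hfil)
  let C : Code M N T K P :=
    { enc := enc
      enc_local := by
        intro i w w' hw
        have : (fun x : Fin n × Fin T₀ => S.blockInput (sym w x.1) i x.2) =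
            fun x => S.blockInput (sym w' x.1) i x.2 := by
          ext1 x
          rw [S.blockInput_congr]
          intro a ha
          simp only [sym, hw a ha]
        simp only [enc, this]
      power := by
        intro i w t
        by_cases ht : ∃ x, blockTime hT x = t
        · obtain ⟨x, rfl⟩ := ht
          rw [henc]
          exact (S.power_blockInput_le (by positivity) (fun a l => norm_qam_le hΔ _) i x.2).trans hP
        · simp only [enc, Function.extend_apply' _ _ _ ht, Pi.zero_apply, norm_zero]
          simpa using (sq_nonneg _).trans hP
      dec := fun j y a => decodeWithin hK c r (word j a y)
      dec_measurable := fun j => measurable_pi_lambda _ fun a =>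
        (Measurable.of_discrete (f := decodeWithin hK c r)).comp (hword j a) }
  refine ⟨C, fun j => ?_⟩
  set p := (noise T N).real {z | r < (Finset.univ.filter fun τ : Fin n =>
    (fun t => z (blockTime hT (τ, t))) ∈ {z | Δ / 2 ≤ S.noiseSize j z}).card} with hp
  have hle : ∀ w : Msg → Fin K, (noise T N).real
      {z | C.dec j (received h j (fun i => C.enc i w) z) ≠ fun a => w a.1} ≤ p := by
    intro w
    refine measureReal_mono ?_
    intro z hz
    by_contra hbad
    apply hz
    simp only [Set.mem_ofPred_eq, not_lt] at hbad
    ext1 a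
    refine decodeWithin_eq hK hc (le_trans (Finset.card_le_card ?_) hbad)
    intro τ hτ
    simp only [Finset.mem_filter, Finset.mem_univ, true_and] at hτ ⊢
    by_contra hsmall
    rw [not_le] at hsmall
    apply hτ
    ext1 l
    have hrec : (fun t => received h j (fun i => C.enc i w) z (blockTime hT (τ, t))) =
        received h j (S.blockInput (sym w τ)) fun t => z (blockTime hT (τ, t)) := by
      ext1 t
      simp only [received]
      congr 1
      refine Finset.sum_congr rfl fun i _ => ?_
      rw [← henc i w (τ, t)]
    simp only [word]
    rw [hrec, S.filtered_received]
    exact (quantize_qam_add hΔ hQ _ ((S.norm_filtered_le j a _ l).trans_lt hsmall)).symm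
  unfold Code.errorProb
  have hcard : (0 : ℝ) < Fintype.card (Msg → Fin K) := by
    have : Nonempty (Fin K) := ⟨⟨0, hK⟩⟩
    exact_mod_cast Fintype.card_pos
  rw [div_le_iff₀ hcard]
  refine (Finset.sum_le_sum fun w _ => hle w).trans ?_
  simp [mul_comm]

end Block

theorem rateAchievable_zero {M N : ℕ} (h : Channel M N) {P : ℝ} (hP : 0 ≤ P) :
    RateAchievable h P 0 := by
  intro ε hε
  refine Eventually.of_forall fun T => ⟨1, by simp, ⟨⟨fun _ _ _ _ => 0, fun _ _ _ _ => rfl,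
    fun _ _ _ => by simpa using hP, fun _ _ _ => 0, fun _ => measurable_const⟩, fun j => ?_⟩⟩
  have : ∀ w : Msg → Fin 1, (fun _ : Desired j => (0 : Fin 1)) = fun a => w a.1 :=
    fun w => Subsingleton.elim _ _
  simp [Code.errorProb, ← this, hε.le]

/-- With modulation at spacing `Δ`, a fraction `2 δ` of redundancy corrects the fraction `δ` of
blocks in which the noise is too large. -/
theorem LinearScheme.rateAchievable {M N T₀ b : ℕ} {h : Channel M N} (S : LinearScheme h T₀ b)
    (hT₀ : 0 < T₀) {Q : ℕ} {Δ P δ R : ℝ} (hQ : 0 < Q) (hΔ : 0 < Δ)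
    (hP : (S.gain * (2 * Δ * Q)) ^ 2 ≤ P) (hδ : S.confusion Δ < δ) (hR : 0 ≤ R)
    (hRQ : T₀ * R ≤ (1 - 2 * δ) * (2 * b * Real.logb 2 Q) - 1 - 1) : RateAchievable h P R := by
  classical
  intro ε hε
  set X := (1 - 2 * δ) * (2 * b * Real.logb 2 Q) - 1 with hX
  have hgap : 0 < δ - S.confusion Δ := sub_pos.2 hδ
  have hδ0 : 0 ≤ δ := (S.confusion_nonneg Δ).trans hδ.le
  have hn : Tendsto (fun T : ℕ => ((T / T₀ : ℕ) : ℝ)) atTop atTop :=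
    tendsto_natCast_atTop_atTop.comp (Nat.tendsto_div_const_atTop hT₀.ne')
  filter_upwards [hn.eventually_ge_atTop 1, hn.eventually_ge_atTop (X - 1),
    hn.eventually_ge_atTop (1 / (4 * (δ - S.confusion Δ) ^ 2 * ε))] with T h1 h2 h3
  set n := T / T₀ with hn_def
  have hn0 : 0 < n := by exact_mod_cast (zero_lt_one.trans_le h1)
  have hnT : n * T₀ ≤ T := Nat.div_mul_le_self T T₀
  have hTn : T ≤ (n + 1) * T₀ := (Nat.lt_mul_of_div_lt (Nat.lt_succ_self n) hT₀).le
  set r := ⌊δ * n⌋₊ with hr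
  have : Nonempty (Fin Q) := ⟨⟨0, hQ⟩⟩
  obtain ⟨C, hC, hcard⟩ := exists_code_hammingDist (Fin b → Fin Q × Fin Q) n (2 * r)
  let c : Fin C.card → Fin n → Fin b → Fin Q × Fin Q := fun k => (C.equivFin.symm k).1
  have hc : ∀ k k', k ≠ k' → 2 * r < hammingDist (c k) (c k') := fun k k' hk =>
    hC _ (C.equivFin.symm k).2 _ (C.equivFin.symm k').2 fun h =>
      hk (C.equivFin.symm.injective (Subtype.ext h))
  have hK : 0 < C.card := by
    by_contra h0
    rw [not_lt, Nat.le_zero] at h0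
    rw [h0, zero_mul] at hcard
    exact absurd hcard (not_le.2 (pow_pos Fintype.card_pos n))
  obtain ⟨code, hcode⟩ := S.exists_code hnT hQ hΔ hP hK c hc
  refine ⟨C.card, ?_, code, fun j => (hcode j).trans ?_⟩
  · set lq := 2 * b * Real.logb 2 Q with hlq
    have hlq0 : 0 ≤ lq := by
      have : (1 : ℝ) ≤ Q := by exact_mod_cast hQ
      have := Real.logb_nonneg one_lt_two this
      positivity
    have hq : ((Fintype.card (Fin b → Fin Q × Fin Q) : ℕ) : ℝ) = (2 : ℝ) ^ lq := by
      have hQ' : (0 : ℝ) < Q := by exact_mod_cast hQ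
      rw [hlq, show 2 * b * Real.logb 2 Q = Real.logb 2 Q * ((2 * b : ℕ) : ℝ) by push_cast; ring,
        Real.rpow_mul two_pos.le, Real.rpow_logb two_pos (by norm_num) hQ', Real.rpow_natCast]
      simp [pow_mul, sq]
    have hcard' : ((2 : ℝ) ^ lq) ^ n ≤ C.card * (2 ^ n * ((2 : ℝ) ^ lq) ^ (2 * r)) := by
      rw [← hq]
      exact_mod_cast hcard
    have hrn : (r : ℝ) ≤ δ * n := Nat.floor_le (by positivity)
    have hpos : (0 : ℝ) < 2 ^ n * ((2 : ℝ) ^ lq) ^ (2 * r) := by positivity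
    refine le_of_mul_le_mul_right (le_trans ?_ hcard') hpos
    have e1 : (2 : ℝ) ^ ((T : ℝ) * R) * (2 ^ n * ((2 : ℝ) ^ lq) ^ (2 * r)) =
        2 ^ ((T : ℝ) * R + (n + lq * (2 * r : ℕ))) := by
      rw [← Real.rpow_mul_natCast two_pos.le, ← Real.rpow_natCast, ← Real.rpow_add two_pos,
        ← Real.rpow_add two_pos]
    rw [e1, ← Real.rpow_mul_natCast two_pos.le]
    refine Real.rpow_le_rpow_of_exponent_le one_le_two ?_
    have hTR : (T : ℝ) * R ≤ (n + 1) * (X - 1) := by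
      have : (T : ℝ) ≤ (n + 1) * T₀ := by exact_mod_cast hTn
      calc (T : ℝ) * R ≤ (n + 1) * T₀ * R := mul_le_mul_of_nonneg_right this hR
        _ = (n + 1) * (T₀ * R) := by ring
        _ ≤ (n + 1) * (X - 1) := mul_le_mul_of_nonneg_left hRQ (by positivity)
    have hrl : lq * (2 * r) ≤ lq * (2 * (δ * n)) :=
      mul_le_mul_of_nonneg_left (by linarith) hlq0
    push_cast
    have hnX : (n : ℝ) * X = n * lq - lq * (2 * (δ * n)) - n := by rw [hX]; ring
    linarith
  · have hlt := (S.le_confusion Δ j).trans_lt hδ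
    have hch := measureReal_card_blocks_le (Measure.pi fun _ : Fin N => complexGaussian) hn0
      (blockTime_injective hnT) (B := {z | Δ / 2 ≤ S.noiseSize j z})
      (measurableSet_le measurable_const (S.measurable_noiseSize j)) hlt
    refine (measureReal_mono ?_).trans (hch.trans ?_)
    · intro z hz
      exact (Nat.floor_lt (by positivity)).1 hz |>.le
    · have hle : δ - S.confusion Δ ≤
          δ - (Measure.pi fun _ : Fin T₀ => Measure.pi fun _ : Fin N => complexGaussian).real
            {z | Δ / 2 ≤ S.noiseSize j z} := sub_le_sub_left (S.le_confusion Δ j) δ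
      have hsq := pow_le_pow_left₀ hgap.le hle 2
      rw [div_le_iff₀ (by positivity)] at h3
      have hn' : (0 : ℝ) < n := by exact_mod_cast hn0
      have hpos : 0 < (δ - S.confusion Δ) ^ 2 := by positivity
      rw [div_le_iff₀ (by have := hpos.trans_le hsq; positivity)]
      calc (1 : ℝ) ≤ n * (4 * (δ - S.confusion Δ) ^ 2 * ε) := h3
        _ = ε * (4 * n * (δ - S.confusion Δ) ^ 2) := by ring
        _ ≤ _ := by gcongr

/-! ### Asymptotics of the rate -/

theorem tendsto_logb_floor_div {γ : ℝ} (hγ : 0 < γ) :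
    Tendsto (fun P : ℝ => Real.logb 2 (⌊√P / (γ * Real.log P)⌋₊ : ℕ) / Real.logb 2 P) atTop
      (𝓝 (1 / 2)) := by
  have hlog := Real.tendsto_log_atTop
  have hll : Tendsto (fun P : ℝ => Real.log (Real.log P) / Real.log P) atTop (𝓝 0) :=
    (Real.isLittleO_log_id_atTop.tendsto_div_nhds_zero).comp hlog
  have hinv : Tendsto (fun P : ℝ => (Real.log P)⁻¹) atTop (𝓝 0) :=
    tendsto_inv_atTop_zero.comp hlog
  have hy : Tendsto (fun P : ℝ => √P / (γ * Real.log P)) atTop atTop := by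
    have h1 : Tendsto (fun P : ℝ => γ * (Real.log P / P ^ (1 / 2 : ℝ))) atTop (𝓝 (γ * 0)) :=
      ((isLittleO_log_rpow_atTop (by norm_num)).tendsto_div_nhds_zero).const_mul γ
    rw [mul_zero] at h1
    have h2 : Tendsto (fun P : ℝ => γ * (Real.log P / P ^ (1 / 2 : ℝ))) atTop (𝓝[>] 0) := by
      refine tendsto_nhdsWithin_iff.2 ⟨h1, ?_⟩
      filter_upwards [eventually_gt_atTop 1] with P hP
      have := Real.log_pos hP
      exact mul_pos hγ (div_pos this (by positivity))
    refine h2.inv_tendsto_nhdsGT_zero.congr fun P => ?_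
    simp only [Pi.inv_apply]
    rw [Real.sqrt_eq_rpow, ← mul_div_assoc, inv_div]
  have hfl : Tendsto (fun P : ℝ => Real.log ((⌊√P / (γ * Real.log P)⌋₊ : ℝ) /
      (√P / (γ * Real.log P)))) atTop (𝓝 0) := by
    have := (tendsto_nat_floor_div_atTop (R := ℝ)).comp hy
    have h2 := ((Real.continuousAt_log one_ne_zero).tendsto).comp this
    rw [Real.log_one] at h2
    exact h2
  have hmain : Tendsto (fun P : ℝ => Real.log ((⌊√P / (γ * Real.log P)⌋₊ : ℝ) /
      (√P / (γ * Real.log P))) * (Real.log P)⁻¹ + (1 / 2 - Real.log γ * (Real.log P)⁻¹ -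
        Real.log (Real.log P) / Real.log P)) atTop
      (𝓝 (0 * 0 + (1 / 2 - Real.log γ * 0 - 0))) :=
    (hfl.mul hinv).add (((hinv.const_mul _).const_sub _).sub hll)
  simp only [mul_zero, sub_zero, zero_add] at hmain
  refine hmain.congr' ?_
  filter_upwards [eventually_gt_atTop 1, hy.eventually_ge_atTop 1] with P hP hyP
  have hlP := Real.log_pos hP
  have hfloor : (0 : ℝ) < (⌊√P / (γ * Real.log P)⌋₊ : ℝ) := by
    exact_mod_cast Nat.floor_pos.2 hyP
  have hsq : 0 < √P := Real.sqrt_pos.2 (zero_lt_one.trans hP)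
  rw [Real.log_div hfloor.ne' (by positivity), Real.log_div hsq.ne' (by positivity),
    Real.log_mul hγ.ne' hlP.ne', Real.log_sqrt (zero_lt_one.trans hP).le, Real.logb, Real.logb,
    div_div_div_cancel_right₀ (Real.log_pos one_lt_two).ne']
  field_simp
  ring

/-- A linear scheme with `b` streams for each message over `T₀` channel uses gives `6 b / T₀`
degrees of freedom per user. -/
theorem LinearScheme.doFAchievable {M N T₀ b : ℕ} {h : Channel M N} (S : LinearScheme h T₀ b)
    (hT₀ : 0 < T₀) : DoFAchievable h (6 * (b : ℝ) / T₀) := by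
  set γ := 2 * S.gain with hγ_def
  have hγ : 0 < γ := mul_pos two_pos S.gain_pos
  let Q : ℝ → ℕ := fun P => ⌊√P / (γ * Real.log P)⌋₊
  let δ : ℝ → ℝ := fun P => S.confusion (Real.log P) + (Real.log P)⁻¹
  let Y : ℝ → ℝ := fun P => (1 - 2 * δ P) * (2 * b * Real.logb 2 (Q P)) - 1 - 1
  have hT₀' : (0 : ℝ) < T₀ := by exact_mod_cast hT₀
  refine ⟨fun P => max 0 (Y P) / T₀, ?_, ?_⟩
  · intro P hP
    rcases le_or_gt (Y P) 0 with hY | hY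
    · simp only [max_eq_left hY, zero_div]
      exact rateAchievable_zero h hP.le
    have hQ : 0 < Q P := by
      by_contra h0
      rw [not_lt, Nat.le_zero] at h0
      simp only [Y, h0, Nat.cast_zero, Real.logb_zero, mul_zero] at hY
      linarith
    have hQ1 : 1 ≤ √P / (γ * Real.log P) := Nat.floor_pos.1 hQ
    have hlog : 0 < Real.log P := by
      by_contra hneg
      have : √P / (γ * Real.log P) ≤ 0 :=
        div_nonpos_of_nonneg_of_nonpos (Real.sqrt_nonneg _)
          (mul_nonpos_of_nonneg_of_nonpos hγ.le (not_lt.1 hneg))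
      linarith
    refine S.rateAchievable hT₀ (Q := Q P) (Δ := Real.log P) (δ := δ P) hQ hlog ?_ ?_ ?_ ?_
    · have h1 : (Q P : ℝ) ≤ √P / (γ * Real.log P) := Nat.floor_le (by linarith)
      rw [le_div_iff₀ (by positivity)] at h1
      have h2 : S.gain * (2 * Real.log P * Q P) ≤ √P := by
        refine le_trans (le_of_eq ?_) h1
        rw [hγ_def]
        ring
      have h3 : 0 ≤ S.gain * (2 * Real.log P * Q P) := by
        have := S.gain_pos
        positivity
      calc _ ≤ √P ^ 2 := pow_le_pow_left₀ h3 h2 2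
        _ = P := Real.sq_sqrt hP.le
    · have := inv_pos.2 hlog
      simp only [δ]
      linarith
    · positivity
    · rw [mul_div_cancel₀ _ hT₀'.ne', max_eq_right hY.le]
  · have hδ : Tendsto δ atTop (𝓝 0) := by
      have := (S.tendsto_confusion.comp Real.tendsto_log_atTop).add
        (tendsto_inv_atTop_zero.comp Real.tendsto_log_atTop)
      rw [add_zero] at this
      exact this
    have hL : Tendsto (fun P : ℝ => Real.logb 2 P) atTop atTop :=
      Real.tendsto_logb_atTop one_lt_two
    have hY : Tendsto (fun P => Y P / Real.logb 2 P) atTop (𝓝 b) := by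
      have h1 := (((hδ.const_mul 2).const_sub 1).mul
        ((tendsto_logb_floor_div hγ).const_mul (2 * (b : ℝ)))).sub
        ((tendsto_inv_atTop_zero.comp hL).const_mul 2)
      have h2 : (1 - 2 * 0) * (2 * (b : ℝ) * (1 / 2)) - 2 * 0 = b := by ring
      rw [h2] at h1
      refine h1.congr fun P => ?_
      simp only [Y, Q, Function.comp]
      ring
    have hmax := ((tendsto_const_nhds (x := (0 : ℝ))).max hY).const_mul (6 / (T₀ : ℝ))
    rw [max_eq_right (Nat.cast_nonneg b), div_mul_eq_mul_div] at hmax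
    refine hmax.congr' ?_
    filter_upwards [hL.eventually_gt_atTop 0] with P hP
    rw [show (0 : ℝ) = 0 / Real.logb 2 P by rw [zero_div], max_div_div_right hP.le, zero_div]
    ring

end XMulticast

end

theorem lemma3 (M N : ℕ) (hM : 0 < M) (hN : 0 < N)
    (ν : Measure ℂ) [IsProbabilityMeasure ν] [NullSingletonClass ν] :
    (∀ᵐ h ∂XMulticast.channelLaw ν M N,
      XMulticast.DoFAchievable h (XMulticast.d₁₂ M N)) ∧
    XMulticast.LinearDoFAchievable ν M N (XMulticast.d₁₂ M N) := by
  have hlin := XMulticast.linearDoFAchievable_d₁₂ ν (N := N) hM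
  refine ⟨?_, hlin⟩
  obtain ⟨T, b, hT, hd, hae⟩ := hlin
  filter_upwards [hae] with h hS
  rw [← hd]
  exact hS.some.doFAchievable hT
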